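/- Let $n \ge 1$ and let $d_1,\dots,d_n \ge 1$ be integers with $D := \max_i d_i \ge 2$. Let $\mathcal H_{(d)}$ be the space of systems $f=(f_1,\dots,f_n)$ of homogeneous polynomials $f_i=\sum_{|\alpha|=d_i} f_{i,\alpha}z^\alpha\in\mathbb C[z_0,\dots,z_n]$ of degree $d_i$, with the unitarily invariant inner product $\langle f,g\rangle=\sum_{i=1}^n\sum_{|\alpha|=d_i}\frac{\alpha_0!\cdots\alpha_n!}{d_i!}f_{i,\alpha}\overline{g_{i,\alpha}}$ and its norm. For nonzero $f \in \mathcal H_{(d)}$ and nonzero $x \in \mathbb C^{n+1}$, let $x^\perp$ be the Hermitian orthogonal complement of $x$ and define the condition number by $$\mu(f,x)=\|f\|\,\Bigl\|\bigl(Df(x)|_{x^\perp}\bigr)^{-1}\operatorname{diag}\bigl(\sqrt{d_i}\,\|x\|^{d_i-1}\bigr)\Bigr\|$$ (operator norm) if $\operatorname{rank} Df(x)|_{x^\perp}=n$, and $\mu(f,x)=\infty$ otherwise. For nonzero $x,y\in\mathbb C^{n+1}$ let $d_R(x,y)=\arccos\frac{|\langle x,y\rangle|}{\|x\|\,\|y\|}\in[0,\pi/2]$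 be the Riemannian (Fubini–Study) distance of their classes in $\mathbb P_n(\mathbb C)$. Let $f,g\in\mathcal H_{(d)}$ and $x,y\in\mathbb C^{n+1}$ be nonzero, with $\operatorname{rank} Df(x)|_{x^\perp}=n$, and suppose that $$u:=\tfrac12 D^{3/2}\mu(f,x)\,d_R(x,y)\le \tfrac1{20},\qquad v:=D^{1/2}\mu(f,x)\left\|\frac f{\|f\|}-\frac g{\|g\|}\right\|\le\tfrac1{20}.$$ Then $\operatorname{rank} Dg(y)|_{y^\perp}=n$, and $$(1-3.805\,u-v)\,\mu(g,y)\le\mu(f,x)\le(1+3.504\,u+v)\,\mu(g,y).$$ -/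

import Mathlib

noncomputable section

/-- The space `H_(d)` of systems `f = (f_1, …, f_n)` of homogeneous polynomials in the `n + 1`
variables `z_0, …, z_n` over `ℂ`, with `f_i` of degree `d_i`. -/
abbrev HomSystem {n : ℕ} (d : Fin n → ℕ) : Type :=
  (i : Fin n) → MvPolynomial.homogeneousSubmodule (Fin (n + 1)) ℂ (d i)

namespace HomSystem

variable {n : ℕ} {d : Fin n → ℕ}

/-- The unitarily invariant inner product
`⟨f, g⟩ = ∑ i, ∑_{|α| = d_i} (α_0! ⋯ α_n! / d_i!) f_{i,α} conj (g_{i,α})`. -/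
def weylInner (f g : HomSystem d) : ℂ :=
  ∑ i, ∑ α ∈ Finset.finsuppAntidiag (Finset.univ : Finset (Fin (n + 1))) (d i),
    (((∏ j, (α j).factorial : ℕ) : ℂ) / ((d i).factorial : ℂ)) *
      (MvPolynomial.coeff α (f i : MvPolynomial (Fin (n + 1)) ℂ) *
        starRingEnd ℂ (MvPolynomial.coeff α (g i : MvPolynomial (Fin (n + 1)) ℂ)))

/-- The norm on `H_(d)` of the unitarily invariant inner product. -/
def weylNorm (f : HomSystem d) : ℝ := Real.sqrt (weylInner f f).re

/-- The normalized system `f / ‖f‖`. -/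
def normalize (f : HomSystem d) : HomSystem d := ((weylNorm f : ℂ)⁻¹) • f

/-- The polynomial map `ℂ^{n+1} → ℂ^n` given by the system. -/
def toMap (f : HomSystem d) (z : EuclideanSpace ℂ (Fin (n + 1))) : EuclideanSpace ℂ (Fin n) :=
  WithLp.toLp 2 fun i => MvPolynomial.eval z.ofLp (f i : MvPolynomial (Fin (n + 1)) ℂ)

/-- The restriction `Df(x)|_{x^⊥}` of the (complex) derivative of `f` at `x` to the Hermitian
orthogonal complement of `x`. -/
def derivPerp (f : HomSystem d) (x : EuclideanSpace ℂ (Fin (n + 1))) :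
    (ℂ ∙ x)ᗮ →L[ℂ] EuclideanSpace ℂ (Fin n) :=
  (fderiv ℂ (toMap f) x).comp (ℂ ∙ x)ᗮ.subtypeL

/-- The rank of `Df(x)|_{x^⊥}`. -/
def rankPerp (f : HomSystem d) (x : EuclideanSpace ℂ (Fin (n + 1))) : ℕ :=
  Module.finrank ℂ (LinearMap.range (derivPerp f x : (ℂ ∙ x)ᗮ →ₗ[ℂ] EuclideanSpace ℂ (Fin n)))

/-- The diagonal operator `diag (√d_i * ‖x‖^(d_i - 1))` on `ℂ^n`. -/
def scaling (d : Fin n → ℕ) (x : EuclideanSpace ℂ (Fin (n + 1))) :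
    EuclideanSpace ℂ (Fin n) →L[ℂ] EuclideanSpace ℂ (Fin n) :=
  Matrix.toEuclideanCLM (𝕜 := ℂ)
    (Matrix.diagonal fun i => ((Real.sqrt (d i) * ‖x‖ ^ (d i - 1) : ℝ) : ℂ))

open scoped Classical in
/-- The condition number
`μ(f, x) = ‖f‖ * ‖(Df(x)|_{x^⊥})⁻¹ ∘ diag (√d_i * ‖x‖^(d_i - 1))‖` (operator norm),
with the value `∞` if the rank of `Df(x)|_{x^⊥}` is less than `n`. For `x ≠ 0` the space `x^⊥` has
dimension `n`, so that the restricted derivative is invertible when its rank is `n`. -/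
def condNumber (f : HomSystem d) (x : EuclideanSpace ℂ (Fin (n + 1))) : ENNReal :=
  if rankPerp f x = n then
    ENNReal.ofReal (weylNorm f * ‖((derivPerp f x).inverse).comp (scaling d x)‖)
  else ⊤

/-- The maximal degree `D = max d_i`. -/
def maxDegree (d : Fin n → ℕ) : ℕ := Finset.univ.sup d

end HomSystem

/-- The Riemannian (Fubini–Study) distance in `P_n(ℂ)` between the lines through the nonzero
vectors `x` and `y`: the angle in `[0, π/2]` between these complex lines, normalized so that its
sine is the projective distance `inf_{λ ≠ 0} ‖x - λ y‖ / ‖x‖`. -/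
def riemannDist {m : ℕ} (x y : EuclideanSpace ℂ (Fin m)) : ℝ :=
  Real.arccos (‖(Inner.inner ℂ x y : ℂ)‖ / (‖x‖ * ‖y‖))

namespace HomSystem

variable {n : ℕ} {d : Fin n → ℕ}

/-- `u = D^{3/2} μ(f, x) d_R(x, y) / 2`. -/
def uParam (f : HomSystem d) (x y : EuclideanSpace ℂ (Fin (n + 1))) : ℝ :=
  (maxDegree d : ℝ) ^ (3 / 2 : ℝ) * (condNumber f x).toReal * riemannDist x y / 2

/-- `v = D^{1/2} μ(f, x) ‖f / ‖f‖ - g / ‖g‖‖`. -/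
def vParam (f g : HomSystem d) (x : EuclideanSpace ℂ (Fin (n + 1))) : ℝ :=
  (maxDegree d : ℝ) ^ (1 / 2 : ℝ) * (condNumber f x).toReal *
    weylNorm (normalize f - normalize g)

end HomSystem

end

/-!
The condition number `μ(f, x)` is the least constant `C` with
`‖w‖ ≤ C ‖diag (√d_i)⁻¹ D(f/‖f‖)(z) w‖` for all `w ⊥ x`, where `z` is any unit vector of the line
through `x` (`HomSystem.norm_le_condNumber_mul`, `HomSystem.condNumber_le_of_norm_le`). So `1 / μ`
is a smallest singular value, and it changes by at most the size of the perturbation of the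
operator on the right.

To bound that perturbation, a homogeneous polynomial of degree `e` is written as the diagonal of its
polarization, a symmetric `e`-linear form. The Weyl norm of the polynomial is the Frobenius norm of
the corresponding tensor, because each monomial `z^α` arises from `e! / ∏ α_i!` tuples of variables,
and so it bounds the operator norm of the form. The derivative at `z` in the direction `w` is a sum
of `e` values of the form at `(z, …, w, …, z)`, which gives a bound `e` for the derivative at a unit
vector and a bound `e²` for its Lipschitz constant. After division by `√e` these become `D^{1/2}`
and `D^{3/2}`.

The lines through `x` and `y` have unit representatives `z`, `z'` with `⟨z, z'⟩ ≥ 0`, and the rotation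
of the plane they span carries `z^⊥` isometrically to `z'^⊥`, moving unit vectors by at most
`‖z - z'‖ ≤ d_R(x, y)` (`exists_rotation_perp`). Along this identification the two operators differ
by at most `ε = D^{1/2} ‖f/‖f‖ - g/‖g‖‖ + D^{3/2} d_R(x, y)`, and `μ(f, x) ε = 2 u + v`. Hence
`(1 - 2 u - v) μ(g, y) ≤ μ(f, x) ≤ (1 + 2 u + v) μ(g, y)`, which is stronger than the claim.
-/

noncomputable section

/-! ### The symmetric tensor of a homogeneous polynomial -/

namespace MvPolynomial

variable {σ : Type*}

/-- The exponent vector of the monomial `X_{j 0} ⋯ X_{j (e - 1)}`. -/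
def tupleExponent {e : ℕ} (j : Fin e → σ) : σ →₀ ℕ := ∑ k, Finsupp.single (j k) 1

lemma prod_X_tuple {R : Type*} [CommSemiring R] {e : ℕ} (j : Fin e → σ) :
    ∏ k, (X (j k) : MvPolynomial σ R) = monomial (tupleExponent j) 1 := by
  simp only [X, tupleExponent]
  rw [monomial_sum_one]

lemma tupleExponent_mem [Fintype σ] [DecidableEq σ] {e : ℕ} (j : Fin e → σ) :
    tupleExponent j ∈ Finset.finsuppAntidiag (Finset.univ : Finset σ) e := by
  rw [Finset.mem_finsuppAntidiag]
  refine ⟨?_, Finset.subset_univ _⟩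
  simp only [tupleExponent, Finsupp.coe_finsetSum, Finset.sum_apply]
  rw [Finset.sum_comm]
  simp [Finsupp.single_apply]

/-- A monomial of exponent `α` and degree `e` is the product of `e! / ∏ α_i!` different tuples of
variables. -/
lemma card_tupleExponent_fiber [Fintype σ] [DecidableEq σ] {e : ℕ} {α : σ →₀ ℕ}
    (hα : α ∈ Finset.finsuppAntidiag (Finset.univ : Finset σ) e) :
    (∏ i, (α i).factorial) * (Finset.univ.filter fun j : Fin e → σ => tupleExponent j = α).card
      = e.factorial := by
  have h1 := coeff_sum_X_pow_of_fintype (R := ℕ) α e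
  rw [Finset.mem_finsuppAntidiag'] at hα
  rw [if_pos hα.1, Fintype.sum_pow] at h1
  simp only [prod_X_tuple, coeff_sum, coeff_monomial, Finset.sum_boole, Nat.cast_id] at h1
  rw [h1, Finsupp.multinomial_eq_of_support_subset (Finset.subset_univ _), Nat.multinomial_spec,
    ← hα.1, Finsupp.sum_fintype _ _ (by simp)]

/-- The weight `α_0! ⋯ α_n! / e!` of the Weyl inner product. -/
def weylWeight [Fintype σ] (e : ℕ) (α : σ →₀ ℕ) : ℝ :=
  ((∏ i, (α i).factorial : ℕ) : ℝ) / (e.factorial : ℝ)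

lemma weylWeight_pos [Fintype σ] (e : ℕ) (α : σ →₀ ℕ) : 0 < weylWeight e α := by
  unfold weylWeight
  have : 0 < ∏ i, (α i).factorial := Finset.prod_pos fun i _ => Nat.factorial_pos _
  positivity

/-- The weights of the Weyl inner product compensate for the number of tuples with a given
product. -/
lemma sum_weylWeight_mul_tuple [Fintype σ] [DecidableEq σ] {A : Type*} [AddCommGroup A] [Module ℝ A]
    (e : ℕ) (G : (σ →₀ ℕ) → A) :
    ∑ j : Fin e → σ, weylWeight e (tupleExponent j) • G (tupleExponent j)
      = ∑ α ∈ Finset.finsuppAntidiag (Finset.univ : Finset σ) e, G α := by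
  rw [← Finset.sum_fiberwise_of_maps_to (g := fun j : Fin e → σ => tupleExponent j)
    (fun j _ => tupleExponent_mem j)]
  refine Finset.sum_congr rfl fun α hα => ?_
  rw [Finset.sum_congr rfl (g := fun _ => weylWeight e α • G α)
    (fun j hj => by rw [(Finset.mem_filter.1 hj).2]), Finset.sum_const, ← Nat.cast_smul_eq_nsmul ℝ,
    smul_smul]
  have h := card_tupleExponent_fiber hα
  have : ((Finset.univ.filter fun j : Fin e → σ => tupleExponent j = α).card : ℝ) * weylWeight e α
      = 1 := by
    rw [weylWeight, mul_div_assoc', div_eq_one_iff_eq (by positivity), mul_comm]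
    exact_mod_cast h
  rw [this, one_smul]

/-- The entries of the symmetric tensor of the degree `e` part of `p`: the coefficient of each
monomial is distributed evenly over the tuples of variables with that product. -/
def tensorCoeff [Fintype σ] (e : ℕ) (p : MvPolynomial σ ℂ) (j : Fin e → σ) : ℂ :=
  weylWeight e (tupleExponent j) * coeff (tupleExponent j) p

/-- The Frobenius norm of the symmetric tensor of `p`. -/
def tensorNorm [Fintype σ] (e : ℕ) (p : MvPolynomial σ ℂ) : ℝ :=
  Real.sqrt (∑ j : Fin e → σ, ‖tensorCoeff e p j‖ ^ 2)

/-- The polarization of the degree `e` part of `p`: the symmetric multilinear form with diagonal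
`p`. -/
def polarForm [Fintype σ] (e : ℕ) (p : MvPolynomial σ ℂ) :
    ContinuousMultilinearMap ℂ (fun _ : Fin e => EuclideanSpace ℂ σ) ℂ :=
  ∑ j : Fin e → σ, tensorCoeff e p j •
    (ContinuousMultilinearMap.mkPiAlgebra ℂ (Fin e) ℂ).compContinuousLinearMap
      fun k => EuclideanSpace.proj (j k)

lemma polarForm_apply [Fintype σ] (e : ℕ) (p : MvPolynomial σ ℂ) (v : Fin e → EuclideanSpace ℂ σ) :
    polarForm e p v = ∑ j : Fin e → σ, tensorCoeff e p j * ∏ k, v k (j k) := by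
  simp [polarForm]

lemma tensorNorm_nonneg [Fintype σ] (e : ℕ) (p : MvPolynomial σ ℂ) : 0 ≤ tensorNorm e p :=
  Real.sqrt_nonneg _

/-- The operator norm of the polarization is at most the Frobenius norm, by Cauchy–Schwarz. -/
lemma norm_polarForm_le [Fintype σ] (e : ℕ) (p : MvPolynomial σ ℂ) :
    ‖polarForm e p‖ ≤ tensorNorm e p := by
  refine ContinuousMultilinearMap.opNorm_le_bound (tensorNorm_nonneg e p) fun v => ?_
  rw [polarForm_apply]
  refine (norm_sum_le _ _).trans ?_
  simp only [norm_mul, norm_prod]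
  refine (Real.sum_mul_le_sqrt_mul_sqrt _ _ _).trans (le_of_eq ?_)
  unfold tensorNorm
  congr 1
  simp_rw [← Finset.prod_pow]
  rw [← Fintype.prod_sum (fun k i => ‖v k i‖ ^ 2), Real.sqrt_prod _ (fun k _ => by positivity)]
  simp [EuclideanSpace.norm_eq]

lemma tensorNorm_sq_eq_sum [Fintype σ] [DecidableEq σ] (e : ℕ) (p : MvPolynomial σ ℂ) :
    tensorNorm e p ^ 2 = ∑ α ∈ Finset.finsuppAntidiag (Finset.univ : Finset σ) e,
      weylWeight e α * ‖coeff α p‖ ^ 2 := by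
  rw [tensorNorm, Real.sq_sqrt (by positivity), ← sum_weylWeight_mul_tuple]
  refine Finset.sum_congr rfl fun j _ => ?_
  rw [tensorCoeff, norm_mul, Complex.norm_real, Real.norm_of_nonneg (weylWeight_pos _ _).le,
    smul_eq_mul]
  ring

lemma polarForm_diag [Fintype σ] [DecidableEq σ] {e : ℕ} {p : MvPolynomial σ ℂ}
    (hp : p.IsHomogeneous e) (z : EuclideanSpace ℂ σ) : polarForm e p (fun _ => z) = eval z.ofLp p := by
  have hmon : ∀ j : Fin e → σ, ∏ k, z (j k) = ∏ i, z i ^ tupleExponent j i := by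
    intro j
    have h := congrArg (eval z.ofLp) (prod_X_tuple (R := ℂ) j)
    simpa [eval_monomial, Finsupp.prod_fintype] using h
  rw [polarForm_apply]
  have h := sum_weylWeight_mul_tuple e fun α : σ →₀ ℕ => coeff α p * ∏ i, z i ^ α i
  simp only [tensorCoeff, hmon]
  simp only [Complex.real_smul, ← mul_assoc] at h
  rw [h, eval_eq']
  symm
  refine Finset.sum_subset (fun α hα => ?_) fun α _ hα => ?_
  · rw [Finset.mem_finsuppAntidiag]
    refine ⟨?_, Finset.subset_univ _⟩
    have := hp (mem_support_iff.1 hα)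
    rw [← this, Finsupp.weight_apply, Finsupp.sum_fintype _ _ (by simp)]
    simp
  · rw [notMem_support_iff.1 hα, zero_mul]

/-- The derivative of a homogeneous polynomial in terms of its polarization. -/
lemma hasFDerivAt_eval [Fintype σ] [DecidableEq σ] {e : ℕ} {p : MvPolynomial σ ℂ}
    (hp : p.IsHomogeneous e) (z : EuclideanSpace ℂ σ) :
    HasFDerivAt (fun y : EuclideanSpace ℂ σ => eval y.ofLp p)
      (((polarForm e p).linearDeriv fun _ => z).comp
        (ContinuousLinearMap.pi fun _ => ContinuousLinearMap.id ℂ _)) z := by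
  have h := HasFDerivAt.comp z ((polarForm e p).hasFDerivAt (x := fun _ => z))
    (hasFDerivAt_pi.2 fun _ : Fin e => hasFDerivAt_id (𝕜 := ℂ) z)
  refine h.congr_of_eventuallyEq (Filter.Eventually.of_forall fun y => ?_)
  exact (polarForm_diag hp y).symm

end MvPolynomial

/-! ### Derivatives of homogeneous polynomials through the polarization -/

namespace MvPolynomial

variable {σ : Type*} [Fintype σ]

/-- The derivative at `z` in the direction `w` of a homogeneous polynomial `p` of degree `e`,
written as the sum of the polarization over the possible slots for `w`. -/
def polarDeriv (e : ℕ) (p : MvPolynomial σ ℂ) (z w : EuclideanSpace ℂ σ) : ℂ :=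
  ∑ k : Fin e, polarForm e p (Function.update (fun _ => z) k w)

lemma fderiv_eval_apply [DecidableEq σ] {e : ℕ} {p : MvPolynomial σ ℂ} (hp : p.IsHomogeneous e)
    (z w : EuclideanSpace ℂ σ) :
    fderiv ℂ (fun y : EuclideanSpace ℂ σ => eval y.ofLp p) z w = polarDeriv e p z w := by
  rw [(hasFDerivAt_eval hp z).fderiv]
  simp [polarDeriv, ContinuousMultilinearMap.linearDeriv_apply]

lemma tensorCoeff_sub (e : ℕ) (p q : MvPolynomial σ ℂ) (j : Fin e → σ) :
    tensorCoeff e (p - q) j = tensorCoeff e p j - tensorCoeff e q j := by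
  simp [tensorCoeff, mul_sub]

lemma tensorCoeff_smul (e : ℕ) (c : ℂ) (p : MvPolynomial σ ℂ) (j : Fin e → σ) :
    tensorCoeff e (c • p) j = c * tensorCoeff e p j := by
  simp [tensorCoeff, mul_left_comm]

lemma polarDeriv_sub (e : ℕ) (p q : MvPolynomial σ ℂ) (z w : EuclideanSpace ℂ σ) :
    polarDeriv e (p - q) z w = polarDeriv e p z w - polarDeriv e q z w := by
  simp only [polarDeriv, polarForm_apply, tensorCoeff_sub, sub_mul, Finset.sum_sub_distrib]

lemma polarDeriv_smul (e : ℕ) (c : ℂ) (p : MvPolynomial σ ℂ) (z w : EuclideanSpace ℂ σ) :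
    polarDeriv e (c • p) z w = c * polarDeriv e p z w := by
  simp only [polarDeriv, polarForm_apply, tensorCoeff_smul, mul_assoc, Finset.mul_sum]

lemma tensorNorm_smul (e : ℕ) (c : ℂ) (p : MvPolynomial σ ℂ) :
    tensorNorm e (c • p) = ‖c‖ * tensorNorm e p := by
  simp only [tensorNorm, tensorCoeff_smul, norm_mul, mul_pow, ← Finset.mul_sum]
  rw [Real.sqrt_mul (by positivity), Real.sqrt_sq (norm_nonneg _)]

lemma polarDeriv_smul_point (e : ℕ) (p : MvPolynomial σ ℂ) (t : ℂ) (z w : EuclideanSpace ℂ σ) :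
    polarDeriv e p (t • z) w = t ^ (e - 1) * polarDeriv e p z w := by
  rw [polarDeriv, polarDeriv, Finset.mul_sum]
  refine Finset.sum_congr rfl fun k _ => ?_
  have h : Function.update (fun _ : Fin e => t • z) k w
      = fun i => (if i = k then 1 else t) • Function.update (fun _ : Fin e => z) k w i := by
    funext i
    by_cases hi : i = k
    · subst hi; simp
    · simp [hi]
  rw [h, ContinuousMultilinearMap.map_smul_univ, smul_eq_mul, Finset.prod_ite]
  simp [Finset.filter_ne']

lemma prod_ite_mul_ite_eq {ι : Type*} [Fintype ι] [DecidableEq ι] (i k : ι) (a b : ℝ) :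
    ∏ j, ((if j = i then a else 1) * (if j = k then b else 1)) = a * b := by
  rw [Finset.prod_mul_distrib, Finset.prod_ite_eq' , Finset.prod_ite_eq']
  simp

lemma norm_polarDeriv_le (e : ℕ) (p : MvPolynomial σ ℂ) {z : EuclideanSpace ℂ σ} (hz : ‖z‖ = 1)
    (w : EuclideanSpace ℂ σ) : ‖polarDeriv e p z w‖ ≤ e * tensorNorm e p * ‖w‖ := by
  have hk : ∀ k : Fin e, ‖polarForm e p (Function.update (fun _ => z) k w)‖
      ≤ tensorNorm e p * ‖w‖ := by
    intro k
    refine ((polarForm e p).le_opNorm _).trans ?_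
    have : ∏ j, ‖Function.update (fun _ : Fin e => z) k w j‖ = ‖w‖ := by
      rw [Finset.prod_eq_single k]
      · simp
      · intro j _ hj; simp [hj, hz]
      · simp
    rw [this]
    exact mul_le_mul_of_nonneg_right (norm_polarForm_le e p) (norm_nonneg _)
  refine (norm_sum_le _ _).trans ((Finset.sum_le_sum fun k _ => hk k).trans (le_of_eq ?_))
  simp [mul_assoc]

/-- Moving the base point and the direction by at most `δ` changes the derivative of a homogeneous
polynomial of degree `e` by at most `e² δ`, since each of the `e` terms of the derivative is a
multilinear form in `e` slots. -/
lemma norm_polarDeriv_sub_le (e : ℕ) (p : MvPolynomial σ ℂ) {z z' w w' : EuclideanSpace ℂ σ}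
    {δ : ℝ} (hz : ‖z‖ = 1) (hz' : ‖z'‖ = 1) (hw : ‖w'‖ = ‖w‖) (hδ : ‖z - z'‖ ≤ δ)
    (hδw : ‖w - w'‖ ≤ δ * ‖w‖) :
    ‖polarDeriv e p z w - polarDeriv e p z' w'‖ ≤ e * e * tensorNorm e p * (δ * ‖w‖) := by
  have hδ0 : 0 ≤ δ := (norm_nonneg _).trans hδ
  have hk : ∀ k : Fin e, ‖polarForm e p (Function.update (fun _ => z) k w)
      - polarForm e p (Function.update (fun _ => z') k w')‖
      ≤ tensorNorm e p * (e * (δ * ‖w‖)) := by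
    intro k
    refine ((polarForm e p).norm_image_sub_le' _ _).trans ?_
    refine mul_le_mul (norm_polarForm_le e p) ?_ (Finset.sum_nonneg fun i _ =>
      Finset.prod_nonneg fun j _ => ?_) (tensorNorm_nonneg e p)
    · rw [show (e : ℝ) * (δ * ‖w‖) = ∑ _i : Fin e, δ * ‖w‖ by simp]
      refine Finset.sum_le_sum fun i _ => ?_
      rw [← prod_ite_mul_ite_eq i k δ ‖w‖]
      refine Finset.prod_le_prod (fun j _ => ?_) fun j _ => ?_
      · split_ifs
        · positivity
        · exact le_max_of_le_left (norm_nonneg _)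
      · by_cases hj : j = i
        · subst hj
          by_cases hjk : j = k
          · subst hjk; simpa using hδw
          · simpa [hjk] using hδ
        · by_cases hjk : j = k
          · subst hjk; simp [hj, hw]
          · simp [hj, hjk, hz, hz']
    · split_ifs
      · positivity
      · exact le_max_of_le_left (norm_nonneg _)
  rw [polarDeriv, polarDeriv, ← Finset.sum_sub_distrib]
  refine (norm_sum_le _ _).trans ((Finset.sum_le_sum fun k _ => hk k).trans (le_of_eq ?_))
  simp
  ring

end MvPolynomial

/-! ### Rotating one complex line to another -/

section Rotation

variable {m : ℕ}

/-- The chord is shorter than the arc. -/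
lemma norm_sub_le_riemannDist {z z' : EuclideanSpace ℂ (Fin m)} (hz : ‖z‖ = 1) (hz' : ‖z'‖ = 1)
    {c : ℝ} (hc : 0 ≤ c) (hzz : (Inner.inner ℂ z z' : ℂ) = c) : ‖z - z'‖ ≤ riemannDist z z' := by
  have hc1 : c ≤ 1 := by
    have := norm_inner_le_norm (𝕜 := ℂ) z z'
    rwa [hzz, hz, hz', Complex.norm_real, Real.norm_of_nonneg hc, one_mul] at this
  have hd : riemannDist z z' = Real.arccos c := by
    simp [riemannDist, hz, hz', hzz, abs_of_nonneg hc]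
  rw [hd]
  refine abs_le_of_sq_le_sq' ?_ (Real.arccos_nonneg c) |>.2
  have h1 := Real.one_sub_sq_div_two_le_cos (x := Real.arccos c)
  rw [Real.cos_arccos (by linarith) hc1] at h1
  have h2 := norm_sub_sq (𝕜 := ℂ) z z'
  rw [hzz, hz, hz'] at h2
  simp at h2
  linarith

/-- If `z` and `z'` are unit vectors with `⟨z, z'⟩ ≥ 0`, the rotation carrying `z` to `z'` and fixing
the orthogonal complement of their span maps `z^⊥` to `z'^⊥`, and moves unit vectors by at most
`‖z - z'‖`. -/
lemma exists_rotation_perp {z z' : EuclideanSpace ℂ (Fin m)} (hz : ‖z‖ = 1) (hz' : ‖z'‖ = 1)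
    {c : ℝ} (hc : 0 ≤ c) (hzz : (Inner.inner ℂ z z' : ℂ) = c) {w : EuclideanSpace ℂ (Fin m)}
    (hw : (Inner.inner ℂ z w : ℂ) = 0) :
    ∃ w' : EuclideanSpace ℂ (Fin m), (Inner.inner ℂ z' w' : ℂ) = 0 ∧ ‖w'‖ = ‖w‖ ∧
      ‖w - w'‖ ≤ ‖z - z'‖ * ‖w‖ := by
  have hzz' : (Inner.inner ℂ z' z : ℂ) = c := by rw [← inner_conj_symm, hzz]; simp
  have hc1 : (1 + c : ℝ) ≠ 0 := by positivity
  have hc1' : (1 + c : ℂ) ≠ 0 := by exact_mod_cast hc1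
  set a : ℂ := Inner.inner ℂ z' w with ha
  have hz1' : (Inner.inner ℂ z' z' : ℂ) = 1 := by rw [inner_self_eq_norm_sq_to_K, hz']; simp
  have hs : ‖z + z'‖ ^ 2 = 2 * (1 + c) := by
    have h2 := norm_add_sq (𝕜 := ℂ) z z'
    rw [hzz, hz, hz'] at h2
    simp at h2
    linarith
  have hd : ‖z - z'‖ ^ 2 = 2 * (1 - c) := by
    have h2 := norm_sub_sq (𝕜 := ℂ) z z'
    rw [hzz, hz, hz'] at h2
    simp at h2
    linarith
  have hmove : ‖(a / (1 + c)) • (z + z')‖ ^ 2 = 2 * ‖a‖ ^ 2 / (1 + c) := by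
    rw [norm_smul, mul_pow, hs, norm_div]
    have : ‖(1 + c : ℂ)‖ = 1 + c := by
      rw [← Complex.ofReal_one, ← Complex.ofReal_add, Complex.norm_real,
        Real.norm_of_nonneg (by positivity)]
    rw [this]
    field_simp
  refine ⟨w - (a / (1 + c)) • (z + z'), ?_, ?_, ?_⟩
  · rw [inner_sub_right, inner_smul_right, inner_add_right, hzz', hz1', ← ha]
    field_simp
    ring
  · have h2 := norm_sub_sq (𝕜 := ℂ) w ((a / (1 + c)) • (z + z'))
    have h3 : (Inner.inner ℂ w ((a / (1 + c)) • (z + z')) : ℂ) = ((‖a‖ ^ 2 / (1 + c) : ℝ) : ℂ) := by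
      rw [inner_smul_right, inner_add_right, ← inner_conj_symm w z, ← inner_conj_symm w z', hw,
        ← ha]
      simp only [map_zero, zero_add]
      rw [div_mul_eq_mul_div, Complex.mul_conj, Complex.normSq_eq_norm_sq]
      push_cast
      rfl
    rw [hmove, h3] at h2
    refine (sq_eq_sq₀ (norm_nonneg _) (norm_nonneg _)).1 ?_
    rw [h2, show RCLike.re (((‖a‖ ^ 2 / (1 + c) : ℝ) : ℂ)) = ‖a‖ ^ 2 / (1 + c) from
      Complex.ofReal_re _]
    ring
  · rw [sub_sub_cancel]
    refine abs_le_of_sq_le_sq' ?_ (by positivity) |>.2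
    rw [hmove, mul_pow, hd]
    -- `⟨z', w⟩ = ⟨z' - c z, w⟩`, and `‖z' - c z‖² = 1 - c²`.
    have h4 : a = Inner.inner ℂ (z' - (c : ℂ) • z) w := by
      rw [inner_sub_left, inner_smul_left, hw, mul_zero, sub_zero]
    have h5 : ‖z' - (c : ℂ) • z‖ ^ 2 = 1 - c ^ 2 := by
      have h2 := norm_sub_sq (𝕜 := ℂ) z' ((c : ℂ) • z)
      rw [inner_smul_right, hzz', norm_smul, hz, hz', Complex.norm_real] at h2
      rw [h2]
      simp [← sq]
      norm_cast
      ring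
    have h6 : ‖a‖ ^ 2 ≤ (1 - c ^ 2) * ‖w‖ ^ 2 := by
      rw [← h5, ← mul_pow, h4]
      exact pow_le_pow_left₀ (norm_nonneg _) (norm_inner_le_norm _ _) 2
    rw [div_le_iff₀ (by positivity)]
    nlinarith

/-- The phase of a representative of the second line can be chosen to make the inner product
nonnegative. -/
lemma exists_unit_smul_inner_nonneg {x y : EuclideanSpace ℂ (Fin m)} (hx : x ≠ 0) (hy : y ≠ 0) :
    ∃ (s t : ℂ) (z z' : EuclideanSpace ℂ (Fin m)) (c : ℝ), x = s • z ∧ y = t • z' ∧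
      ‖z‖ = 1 ∧ ‖z'‖ = 1 ∧ 0 ≤ c ∧ (Inner.inner ℂ z z' : ℂ) = c ∧
      riemannDist z z' = riemannDist x y := by
  have hx0 : ‖x‖ ≠ 0 := norm_ne_zero_iff.2 hx
  have hy0 : ‖y‖ ≠ 0 := norm_ne_zero_iff.2 hy
  obtain ⟨u, hu, hu'⟩ : ∃ u : ℂ, ‖u‖ = 1 ∧ u * Inner.inner ℂ x y = ‖(Inner.inner ℂ x y : ℂ)‖ := by
    by_cases h : (Inner.inner ℂ x y : ℂ) = 0
    · exact ⟨1, by simp, by simp [h]⟩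
    · have h0 : ‖(Inner.inner ℂ x y : ℂ)‖ ≠ 0 := norm_ne_zero_iff.2 h
      refine ⟨‖(Inner.inner ℂ x y : ℂ)‖ / Inner.inner ℂ x y, ?_, ?_⟩
      · rw [norm_div, Complex.norm_real, norm_norm, div_self h0]
      · field_simp
  have hu0 : u ≠ 0 := by rintro rfl; simp at hu
  have hx0' : (‖x‖ : ℂ) ≠ 0 := by exact_mod_cast hx0
  have hy0' : (‖y‖ : ℂ) ≠ 0 := by exact_mod_cast hy0
  have h1 : ‖(‖x‖ : ℂ)⁻¹ • x‖ = 1 := by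
    rw [norm_smul, norm_inv, Complex.norm_real, norm_norm, inv_mul_cancel₀ hx0]
  have h2 : ‖(u * (‖y‖ : ℂ)⁻¹) • y‖ = 1 := by
    rw [norm_smul, norm_mul, hu, norm_inv, Complex.norm_real, norm_norm, one_mul,
      inv_mul_cancel₀ hy0]
  have h3 : (Inner.inner ℂ ((‖x‖ : ℂ)⁻¹ • x) ((u * (‖y‖ : ℂ)⁻¹) • y) : ℂ)
      = ((‖(Inner.inner ℂ x y : ℂ)‖ / (‖x‖ * ‖y‖) : ℝ) : ℂ) := by
    rw [inner_smul_left, inner_smul_right]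
    push_cast
    rw [← hu', map_inv₀, Complex.conj_ofReal]
    field_simp
  refine ⟨‖x‖, ‖y‖ * u⁻¹, (‖x‖ : ℂ)⁻¹ • x, (u * (‖y‖ : ℂ)⁻¹) • y,
    ‖(Inner.inner ℂ x y : ℂ)‖ / (‖x‖ * ‖y‖), ?_, ?_, h1, h2, by positivity, h3, ?_⟩
  · rw [smul_smul, mul_inv_cancel₀ hx0', one_smul]
  · rw [smul_smul]
    have : ‖y‖ * u⁻¹ * (u * (‖y‖ : ℂ)⁻¹) = 1 := by field_simp
    rw [this, one_smul]
  · rw [riemannDist, h1, h2, h3, Complex.norm_real, Real.norm_of_nonneg (by positivity)]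
    simp [riemannDist]

end Rotation

/-! ### The condition number as the best constant in a lower bound -/

namespace HomSystem

open MvPolynomial

variable {n : ℕ} {d : Fin n → ℕ}

lemma isHomogeneous_apply (f : HomSystem d) (i : Fin n) :
    (f i : MvPolynomial (Fin (n + 1)) ℂ).IsHomogeneous (d i) :=
  (mem_homogeneousSubmodule _ _).1 (f i).2

lemma weylNorm_eq_sqrt (f : HomSystem d) :
    weylNorm f = Real.sqrt (∑ i, tensorNorm (d i) (f i : MvPolynomial (Fin (n + 1)) ℂ) ^ 2) := by
  rw [weylNorm]
  congr 1
  simp only [weylInner, Complex.re_sum, tensorNorm_sq_eq_sum]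
  refine Finset.sum_congr rfl fun i _ => Finset.sum_congr rfl fun α _ => ?_
  rw [Complex.mul_conj, Complex.normSq_eq_norm_sq, weylWeight, ← Complex.ofReal_natCast,
    ← Complex.ofReal_natCast, ← Complex.ofReal_div, ← Complex.ofReal_mul, Complex.ofReal_re]

lemma weylNorm_nonneg (f : HomSystem d) : 0 ≤ weylNorm f := Real.sqrt_nonneg _

lemma weylNorm_smul (c : ℂ) (f : HomSystem d) : weylNorm (c • f) = ‖c‖ * weylNorm f := by
  simp only [weylNorm_eq_sqrt, Pi.smul_apply, Submodule.coe_smul, tensorNorm_smul, mul_pow,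
    ← Finset.mul_sum]
  rw [Real.sqrt_mul (by positivity), Real.sqrt_sq (norm_nonneg _)]

lemma weylNorm_pos {f : HomSystem d} (hf : f ≠ 0) : 0 < weylNorm f := by
  refine lt_of_le_of_ne (weylNorm_nonneg f) fun h => hf ?_
  rw [weylNorm_eq_sqrt, eq_comm, Real.sqrt_eq_zero (by positivity),
    Finset.sum_eq_zero_iff_of_nonneg fun i _ => by positivity] at h
  funext i
  have h0 : polarForm (d i) (f i : MvPolynomial (Fin (n + 1)) ℂ) = 0 := by
    have := norm_polarForm_le (d i) (f i : MvPolynomial (Fin (n + 1)) ℂ)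
    rw [pow_eq_zero_iff two_ne_zero |>.1 (h i (Finset.mem_univ i))] at this
    exact norm_le_zero_iff.1 this
  refine Subtype.ext (MvPolynomial.funext fun x => ?_)
  have := polarForm_diag (isHomogeneous_apply f i) (WithLp.toLp 2 x)
  rw [h0] at this
  simpa using this.symm

lemma weylNorm_normalize {f : HomSystem d} (hf : f ≠ 0) : weylNorm (normalize f) = 1 := by
  have h := weylNorm_pos hf
  rw [normalize, weylNorm_smul, norm_inv, Complex.norm_real, Real.norm_of_nonneg h.le,
    inv_mul_cancel₀ h.ne']

/-- The vector `diag (√d_i)⁻¹ Df(z) w`, with the derivative written through the polarization of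
`f`. -/
def scaledDeriv (f : HomSystem d) (z w : EuclideanSpace ℂ (Fin (n + 1))) :
    EuclideanSpace ℂ (Fin n) :=
  WithLp.toLp 2 fun i =>
    ((Real.sqrt (d i))⁻¹ : ℝ) * polarDeriv (d i) (f i : MvPolynomial (Fin (n + 1)) ℂ) z w

lemma derivPerp_apply (f : HomSystem d) (x : EuclideanSpace ℂ (Fin (n + 1))) (w : (ℂ ∙ x)ᗮ)
    (i : Fin n) : derivPerp f x w i
      = polarDeriv (d i) (f i : MvPolynomial (Fin (n + 1)) ℂ) x w := by
  rw [← fderiv_eval_apply (isHomogeneous_apply f i)]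
  have hd : DifferentiableAt ℂ (toMap f) x := by
    rw [differentiableAt_euclidean]
    exact fun i => (hasFDerivAt_eval (isHomogeneous_apply f i) x).differentiableAt
  have := ((EuclideanSpace.proj (𝕜 := ℂ) i).hasFDerivAt.comp x hd.hasFDerivAt).fderiv
  exact (congrArg (fun L => L (w : EuclideanSpace ℂ (Fin (n + 1)))) this).symm

lemma scaling_apply (x : EuclideanSpace ℂ (Fin (n + 1))) (v : EuclideanSpace ℂ (Fin n))
    (i : Fin n) :
    scaling d x v i = ((Real.sqrt (d i) * ‖x‖ ^ (d i - 1) : ℝ) : ℂ) * v i := by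
  simp [scaling, Matrix.ofLp_toEuclideanCLM, Matrix.mulVec_diagonal]

lemma scaling_injective (hd : ∀ i, 1 ≤ d i) {x : EuclideanSpace ℂ (Fin (n + 1))} (hx : x ≠ 0) :
    Function.Injective (scaling d x) := by
  intro v v' h
  ext i
  have hi := congrArg (fun u : EuclideanSpace ℂ (Fin n) => u i) h
  simp only [scaling_apply] at hi
  refine mul_left_cancel₀ ?_ hi
  have : 0 < Real.sqrt (d i) := Real.sqrt_pos.2 (by exact_mod_cast hd i)
  have : 0 < ‖x‖ := norm_pos_iff.2 hx
  exact Complex.ofReal_ne_zero.2 (by positivity)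

/-- The vector `diag (√d_i ‖x‖^(d_i - 1))⁻¹ Df(x) w` has norm `‖f‖ ‖diag (√d_i)⁻¹ D(f/‖f‖)(z) w‖` for
each unit vector `z` of the line through `x`. -/
lemma exists_scaling_eq_derivPerp (hd : ∀ i, 1 ≤ d i) {f : HomSystem d} (hf : f ≠ 0)
    {x z : EuclideanSpace ℂ (Fin (n + 1))} (hx : x ≠ 0) (hz : ‖z‖ = 1) {s : ℂ} (hs : x = s • z)
    (w : (ℂ ∙ x)ᗮ) :
    ∃ v, scaling d x v = derivPerp f x w ∧
      ‖v‖ = weylNorm f * ‖scaledDeriv (normalize f) z w‖ := by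
  have hxs : ‖x‖ = ‖s‖ := by rw [hs, norm_smul, hz, mul_one]
  have hx0 : 0 < ‖x‖ := norm_pos_iff.2 hx
  have hx0' : (‖x‖ : ℂ) ≠ 0 := by exact_mod_cast hx0.ne'
  have hW := weylNorm_pos hf
  have hW' : (weylNorm f : ℂ) ≠ 0 := by exact_mod_cast hW.ne'
  refine ⟨WithLp.toLp 2 fun i => (weylNorm f : ℂ) * (s / ‖x‖) ^ (d i - 1) *
    scaledDeriv (normalize f) z w i, ?_, ?_⟩
  · ext i
    rw [scaling_apply, derivPerp_apply]
    have hp : polarDeriv (d i) (f i : MvPolynomial (Fin (n + 1)) ℂ) x w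
        = s ^ (d i - 1) * polarDeriv (d i) (f i : MvPolynomial (Fin (n + 1)) ℂ) z w := by
      rw [← polarDeriv_smul_point, ← hs]
    have hq : Real.sqrt (d i) ≠ 0 := (Real.sqrt_pos.2 (by exact_mod_cast hd i)).ne'
    have hq' : (Real.sqrt (d i) : ℂ) ≠ 0 := by exact_mod_cast hq
    rw [hp]
    simp only [scaledDeriv, normalize, Pi.smul_apply, Submodule.coe_smul, polarDeriv_smul]
    push_cast
    rw [div_pow]
    field_simp
  · have h1 : ∀ i, ‖(s / (‖x‖ : ℂ)) ^ (d i - 1)‖ = 1 := by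
      intro i
      rw [norm_pow, norm_div, Complex.norm_real, norm_norm, hxs, div_self, one_pow]
      exact hxs ▸ hx0.ne'
    rw [EuclideanSpace.norm_eq, EuclideanSpace.norm_eq (scaledDeriv _ _ _)]
    simp only [norm_mul, h1, mul_one, mul_pow, ← Finset.mul_sum]
    rw [Real.sqrt_mul (by positivity), Complex.norm_real, Real.norm_of_nonneg hW.le,
      Real.sqrt_sq hW.le]

lemma finrank_perp {x : EuclideanSpace ℂ (Fin (n + 1))} (hx : x ≠ 0) :
    Module.finrank ℂ (ℂ ∙ x)ᗮ = n := by
  have : Fact (Module.finrank ℂ (EuclideanSpace ℂ (Fin (n + 1))) = n + 1) :=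
    ⟨by simp⟩
  exact Submodule.finrank_orthogonal_span_singleton hx

lemma exists_equiv_of_injective {f : HomSystem d} {x : EuclideanSpace ℂ (Fin (n + 1))}
    (hx : x ≠ 0) (h : Function.Injective (derivPerp f x)) :
    ∃ e : (ℂ ∙ x)ᗮ ≃L[ℂ] EuclideanSpace ℂ (Fin n),
      (e : (ℂ ∙ x)ᗮ →L[ℂ] EuclideanSpace ℂ (Fin n)) = derivPerp f x := by
  have hfr : Module.finrank ℂ (ℂ ∙ x)ᗮ = Module.finrank ℂ (EuclideanSpace ℂ (Fin n)) := by
    rw [finrank_perp hx]; simp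
  refine ⟨(LinearEquiv.ofInjectiveOfFinrankEq
    (derivPerp f x : (ℂ ∙ x)ᗮ →ₗ[ℂ] EuclideanSpace ℂ (Fin n)) h hfr).toContinuousLinearEquiv, ?_⟩
  ext w
  rfl

lemma rankPerp_eq_iff {f : HomSystem d} {x : EuclideanSpace ℂ (Fin (n + 1))} (hx : x ≠ 0) :
    rankPerp f x = n ↔ Function.Injective (derivPerp f x) := by
  have h := LinearMap.finrank_range_add_finrank_ker
    (derivPerp f x : (ℂ ∙ x)ᗮ →ₗ[ℂ] EuclideanSpace ℂ (Fin n))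
  rw [finrank_perp hx] at h
  change _ ↔ Function.Injective (derivPerp f x : (ℂ ∙ x)ᗮ →ₗ[ℂ] EuclideanSpace ℂ (Fin n))
  rw [← LinearMap.ker_eq_bot, ← Submodule.finrank_eq_zero (R := ℂ), rankPerp]
  omega

lemma condNumber_toReal {f : HomSystem d} {x : EuclideanSpace ℂ (Fin (n + 1))}
    (h : rankPerp f x = n) : (condNumber f x).toReal
      = weylNorm f * ‖((derivPerp f x).inverse).comp (scaling d x)‖ := by
  rw [condNumber, if_pos h, ENNReal.toReal_ofReal]
  exact mul_nonneg (weylNorm_nonneg f) (ContinuousLinearMap.opNorm_nonneg _)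

/-- The condition number is an admissible constant in the lower bound for the derivative on
`x^⊥`. -/
lemma norm_le_condNumber_mul (hd : ∀ i, 1 ≤ d i) {f : HomSystem d} (hf : f ≠ 0)
    {x z : EuclideanSpace ℂ (Fin (n + 1))} (hx : x ≠ 0) (hz : ‖z‖ = 1) {s : ℂ} (hs : x = s • z)
    (hrank : rankPerp f x = n) {w : EuclideanSpace ℂ (Fin (n + 1))}
    (hw : (Inner.inner ℂ z w : ℂ) = 0) :
    ‖w‖ ≤ (condNumber f x).toReal * ‖scaledDeriv (normalize f) z w‖ := by
  have hw' : w ∈ (ℂ ∙ x)ᗮ := by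
    rw [Submodule.mem_orthogonal_singleton_iff_inner_right, hs, inner_smul_left, hw, mul_zero]
  obtain ⟨e, he⟩ := exists_equiv_of_injective hx ((rankPerp_eq_iff hx).1 hrank)
  obtain ⟨v, hv, hvn⟩ := exists_scaling_eq_derivPerp hd hf hx hz hs ⟨w, hw'⟩
  have h1 := (((derivPerp f x).inverse).comp (scaling d x)).le_opNorm v
  rw [ContinuousLinearMap.comp_apply, hv, ← he, ContinuousLinearMap.inverse_equiv] at h1
  simp only [ContinuousLinearEquiv.coe_coe, ContinuousLinearEquiv.symm_apply_apply] at h1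
  rw [condNumber_toReal hrank, ← he, ContinuousLinearMap.inverse_equiv]
  refine h1.trans (le_of_eq ?_)
  rw [hvn]
  ring

/-- Every admissible constant in the lower bound for the derivative on `x^⊥` bounds the condition
number, and its existence forces full rank. -/
lemma condNumber_le_of_norm_le (hd : ∀ i, 1 ≤ d i) {f : HomSystem d} (hf : f ≠ 0)
    {x z : EuclideanSpace ℂ (Fin (n + 1))} (hx : x ≠ 0) (hz : ‖z‖ = 1) {s : ℂ} (hs : x = s • z)
    {C : ℝ} (hC : 0 ≤ C)
    (h : ∀ w : EuclideanSpace ℂ (Fin (n + 1)), (Inner.inner ℂ z w : ℂ) = 0 →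
      ‖w‖ ≤ C * ‖scaledDeriv (normalize f) z w‖) :
    rankPerp f x = n ∧ (condNumber f x).toReal ≤ C := by
  have hs0 : s ≠ 0 := by rintro rfl; exact hx (by simpa using hs)
  have hperp : ∀ w : (ℂ ∙ x)ᗮ, (Inner.inner ℂ z (w : EuclideanSpace ℂ (Fin (n + 1))) : ℂ) = 0 := by
    intro w
    have := Submodule.mem_orthogonal_singleton_iff_inner_right.1 w.2
    have h2 := congrArg
      (fun a => (Inner.inner ℂ a (w : EuclideanSpace ℂ (Fin (n + 1))) : ℂ)) hs
    simp only [this, inner_smul_left] at h2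
    exact (mul_eq_zero.1 h2.symm).resolve_left (by simpa using hs0)
  have hW := weylNorm_pos hf
  have hinj : Function.Injective (derivPerp f x) := by
    rw [injective_iff_map_eq_zero]
    intro w hw
    obtain ⟨v, hv, hvn⟩ := exists_scaling_eq_derivPerp hd hf hx hz hs w
    have hv0 : v = 0 := scaling_injective hd hx (by rw [hv, hw, map_zero])
    have h0 : ‖scaledDeriv (normalize f) z w‖ = 0 := by
      rw [hv0, norm_zero, eq_comm] at hvn
      exact (mul_eq_zero.1 hvn).resolve_left hW.ne'
    have := h w (hperp w)
    rw [h0, mul_zero] at this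
    exact Subtype.ext (norm_le_zero_iff.1 this)
  have hrank := (rankPerp_eq_iff hx).2 hinj
  refine ⟨hrank, ?_⟩
  rw [condNumber_toReal hrank, mul_comm, ← le_div_iff₀ hW]
  refine ContinuousLinearMap.opNorm_le_bound _ (by positivity) fun v => ?_
  obtain ⟨e, he⟩ := exists_equiv_of_injective hx hinj
  rw [ContinuousLinearMap.comp_apply, ← he, ContinuousLinearMap.inverse_equiv]
  obtain ⟨v', hv, hvn⟩ := exists_scaling_eq_derivPerp hd hf hx hz hs (e.symm (scaling d x v))
  rw [← he] at hv
  have hvv : v' = v := scaling_injective hd hx (by simpa using hv)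
  have h1 := h _ (hperp (e.symm (scaling d x v)))
  rw [hvv] at hvn
  rw [hvn, div_mul_eq_mul_div, mul_left_comm, mul_div_cancel_left₀ _ hW.ne']
  exact h1

/-! ### Perturbing the system and the point -/

lemma norm_toLp_le_of_forall_le {a : Fin n → ℂ} {b : Fin n → ℝ} {C : ℝ} (hC : 0 ≤ C)
    (h : ∀ i, ‖a i‖ ≤ C * b i) : ‖(WithLp.toLp 2 a : EuclideanSpace ℂ (Fin n))‖
      ≤ C * Real.sqrt (∑ i, b i ^ 2) := by
  rw [EuclideanSpace.norm_eq]
  nth_rw 1 [← Real.sqrt_sq hC]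
  rw [← Real.sqrt_mul (by positivity), Finset.mul_sum]
  refine Real.sqrt_le_sqrt (Finset.sum_le_sum fun i _ => ?_)
  rw [← mul_pow]
  exact pow_le_pow_left₀ (norm_nonneg _) (by simpa using h i) 2

lemma norm_scaledDeriv_le (f : HomSystem d) {z : EuclideanSpace ℂ (Fin (n + 1))} (hz : ‖z‖ = 1)
    (w : EuclideanSpace ℂ (Fin (n + 1))) :
    ‖scaledDeriv f z w‖ ≤ (maxDegree d : ℝ) ^ (1 / 2 : ℝ) * ‖w‖ * weylNorm f := by
  rw [weylNorm_eq_sqrt]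
  refine norm_toLp_le_of_forall_le (by positivity) fun i => ?_
  have hdi : (d i : ℝ) ≤ maxDegree d := by
    exact_mod_cast Finset.le_sup (f := d) (Finset.mem_univ i)
  have h1 : (Real.sqrt (d i))⁻¹ * (d i : ℝ) ≤ (maxDegree d : ℝ) ^ (1 / 2 : ℝ) := by
    rw [← Real.sqrt_eq_rpow, inv_mul_eq_div, Real.div_sqrt]
    exact Real.sqrt_le_sqrt hdi
  rw [norm_mul, Complex.norm_real, Real.norm_of_nonneg (by positivity)]
  have hT := tensorNorm_nonneg (d i) (f i : MvPolynomial (Fin (n + 1)) ℂ)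
  calc _ ≤ (Real.sqrt (d i))⁻¹ * (d i * tensorNorm (d i) (f i).1 * ‖w‖) := by
        gcongr
        exact norm_polarDeriv_le _ _ hz w
    _ = ((Real.sqrt (d i))⁻¹ * d i) * ‖w‖ * tensorNorm (d i) (f i).1 := by ring
    _ ≤ _ := by gcongr

lemma norm_scaledDeriv_sub_le (f : HomSystem d) {z z' w w' : EuclideanSpace ℂ (Fin (n + 1))}
    {δ : ℝ} (hz : ‖z‖ = 1) (hz' : ‖z'‖ = 1) (hw : ‖w'‖ = ‖w‖) (hδ : ‖z - z'‖ ≤ δ)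
    (hδw : ‖w - w'‖ ≤ δ * ‖w‖) :
    ‖scaledDeriv f z w - scaledDeriv f z' w'‖
      ≤ (maxDegree d : ℝ) ^ (3 / 2 : ℝ) * (δ * ‖w‖) * weylNorm f := by
  have hδ0 : 0 ≤ δ := (norm_nonneg _).trans hδ
  rw [weylNorm_eq_sqrt, scaledDeriv, scaledDeriv, ← WithLp.toLp_sub]
  refine norm_toLp_le_of_forall_le (by positivity) fun i => ?_
  have hdi : (d i : ℝ) ≤ maxDegree d := by
    exact_mod_cast Finset.le_sup (f := d) (Finset.mem_univ i)
  have h1 : (Real.sqrt (d i))⁻¹ * (d i * d i : ℝ) ≤ (maxDegree d : ℝ) ^ (3 / 2 : ℝ) := by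
    rw [show (3 / 2 : ℝ) = 1 / 2 + 1 by norm_num, Real.rpow_add_one' (by positivity) (by norm_num),
      ← Real.sqrt_eq_rpow, ← mul_assoc, inv_mul_eq_div, Real.div_sqrt]
    gcongr
  rw [Pi.sub_apply, ← mul_sub, norm_mul, Complex.norm_real, Real.norm_of_nonneg (by positivity)]
  have hT := tensorNorm_nonneg (d i) (f i : MvPolynomial (Fin (n + 1)) ℂ)
  calc _ ≤ (Real.sqrt (d i))⁻¹ * (d i * d i * tensorNorm (d i) (f i).1 * (δ * ‖w‖)) := by
        gcongr
        exact norm_polarDeriv_sub_le _ _ hz hz' hw hδ hδw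
    _ = ((Real.sqrt (d i))⁻¹ * (d i * d i)) * (δ * ‖w‖) * tensorNorm (d i) (f i).1 := by ring
    _ ≤ _ := by gcongr

lemma scaledDeriv_sub (f g : HomSystem d) (z w : EuclideanSpace ℂ (Fin (n + 1))) :
    scaledDeriv (f - g) z w = scaledDeriv f z w - scaledDeriv g z w := by
  rw [scaledDeriv, scaledDeriv, scaledDeriv, ← WithLp.toLp_sub]
  congr 1
  funext i
  simp [polarDeriv_sub, mul_sub]

/-- Replacing `(h, z, w)` by `(k, z', w')` changes `diag (√d_i)⁻¹ Dh(z) w` by at most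
`D^{1/2} ‖h - k‖ + D^{3/2} δ`, relative to `‖w‖`. -/
lemma norm_scaledDeriv_sub_scaledDeriv_le (h : HomSystem d) {k : HomSystem d}
    (hk : weylNorm k = 1) {z z' w w' : EuclideanSpace ℂ (Fin (n + 1))}
    {δ : ℝ} (hz : ‖z‖ = 1) (hz' : ‖z'‖ = 1) (hw : ‖w'‖ = ‖w‖) (hδ : ‖z - z'‖ ≤ δ)
    (hδw : ‖w - w'‖ ≤ ‖z - z'‖ * ‖w‖) :
    ‖scaledDeriv h z w - scaledDeriv k z' w'‖ ≤ ((maxDegree d : ℝ) ^ (1 / 2 : ℝ) *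
      weylNorm (h - k) + (maxDegree d : ℝ) ^ (3 / 2 : ℝ) * δ) * ‖w‖ := by
  have h1 := norm_scaledDeriv_le (h - k) hz w
  have h2 := norm_scaledDeriv_sub_le k hz hz' hw hδ
    (hδw.trans (mul_le_mul_of_nonneg_right hδ (norm_nonneg _)))
  rw [scaledDeriv_sub] at h1
  rw [hk] at h2
  have h3 := norm_sub_le_norm_sub_add_norm_sub (scaledDeriv h z w) (scaledDeriv k z w)
    (scaledDeriv k z' w')
  linarith

end HomSystem

end

theorem theorem2 {n : ℕ} (d : Fin n → ℕ) (hd : ∀ i, 1 ≤ d i)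
    (hD : 2 ≤ HomSystem.maxDegree d)
    (f g : HomSystem d) (hf : f ≠ 0) (hg : g ≠ 0)
    (x y : EuclideanSpace ℂ (Fin (n + 1))) (hx : x ≠ 0) (hy : y ≠ 0)
    (hrank : HomSystem.rankPerp f x = n)
    (hu : HomSystem.uParam f x y ≤ 1 / 20)
    (hv : HomSystem.vParam f g x ≤ 1 / 20) :
    HomSystem.rankPerp g y = n ∧
      (1 - 3.805 * HomSystem.uParam f x y - HomSystem.vParam f g x) *
          (HomSystem.condNumber g y).toReal ≤ (HomSystem.condNumber f x).toReal ∧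
      (HomSystem.condNumber f x).toReal ≤
        (1 + 3.504 * HomSystem.uParam f x y + HomSystem.vParam f g x) *
          (HomSystem.condNumber g y).toReal := by
  obtain ⟨s, t, z, z', c, hs, ht, hz, hz', hc, hzz, hdist⟩ := exists_unit_smul_inner_nonneg hx hy
  have hδ := norm_sub_le_riemannDist hz hz' hc hzz
  have hzz' : (Inner.inner ℂ z' z : ℂ) = c := by rw [← inner_conj_symm, hzz]; simp
  rw [hdist] at hδ
  set ε : ℝ := (HomSystem.maxDegree d : ℝ) ^ (1 / 2 : ℝ) *
    HomSystem.weylNorm (HomSystem.normalize f - HomSystem.normalize g) +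
      (HomSystem.maxDegree d : ℝ) ^ (3 / 2 : ℝ) * riemannDist x y with hε
  set μ := (HomSystem.condNumber f x).toReal with hμ
  set ν := (HomSystem.condNumber g y).toReal with hν
  have hμ0 : 0 ≤ μ := ENNReal.toReal_nonneg
  have hν0 : 0 ≤ ν := ENNReal.toReal_nonneg
  have hδ0 : 0 ≤ riemannDist x y := (norm_nonneg _).trans hδ
  have hu0 : 0 ≤ HomSystem.uParam f x y := by rw [HomSystem.uParam]; positivity
  have hμε : μ * ε = 2 * HomSystem.uParam f x y + HomSystem.vParam f g x := by
    rw [hε, HomSystem.uParam, HomSystem.vParam]; ring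
  have hdiff : ∀ w w' : EuclideanSpace ℂ (Fin (n + 1)), ‖w'‖ = ‖w‖ →
      ‖w - w'‖ ≤ ‖z - z'‖ * ‖w‖ → ‖HomSystem.scaledDeriv (HomSystem.normalize f) z w -
        HomSystem.scaledDeriv (HomSystem.normalize g) z' w'‖ ≤ ε * ‖w‖ := fun w w' h1 h2 =>
    HomSystem.norm_scaledDeriv_sub_scaledDeriv_le _ (HomSystem.weylNorm_normalize hg) hz hz' h1
      hδ h2
  -- Since `2 u + v < 1`, the lower bound for the derivative of `f` survives the perturbation.
  have hpos : 0 < 1 - μ * ε := by rw [hμε]; linarith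
  obtain ⟨hrank', hνle⟩ := HomSystem.condNumber_le_of_norm_le hd hg hy hz' ht
    (C := μ / (1 - μ * ε)) (by positivity) (fun w' hw' => by
      obtain ⟨w, hw, hn, hm⟩ := exists_rotation_perp hz' hz hc hzz' hw'
      have h1 := HomSystem.norm_le_condNumber_mul hd hf hx hz hs hrank hw
      have h2 := hdiff w w' hn.symm (by rwa [norm_sub_rev, norm_sub_rev z, hn])
      have h3 := norm_le_norm_add_norm_sub (HomSystem.scaledDeriv (HomSystem.normalize g) z' w')
        (HomSystem.scaledDeriv (HomSystem.normalize f) z w)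
      rw [norm_sub_rev] at h3
      rw [div_mul_eq_mul_div, le_div_iff₀ hpos]
      have h4 := mul_le_mul_of_nonneg_left (h3.trans (add_le_add_right h2 _)) hμ0
      rw [hn] at h1 h4
      linarith)
  rw [← hν, le_div_iff₀ hpos, hμε] at hνle
  refine ⟨hrank', ?_, ?_⟩
  -- The claimed `3.805 u` exceeds the `2 u` obtained here.
  · nlinarith [mul_nonneg hu0 hν0]
  · have key : μ ≤ ν + ν * (μ * ε) := by
      -- If `ν ε ≥ 1` the inequality is trivial.
      rcases le_or_gt 1 (ν * ε) with h1 | h1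
      · nlinarith
      · have hpos' : 0 < 1 - ν * ε := by linarith
        obtain ⟨-, hμle⟩ := HomSystem.condNumber_le_of_norm_le hd hf hx hz hs
          (C := ν / (1 - ν * ε)) (by positivity) (fun w hw => by
            obtain ⟨w', hw', hn, hm⟩ := exists_rotation_perp hz hz' hc hzz hw
            have h1 := HomSystem.norm_le_condNumber_mul hd hg hy hz' ht hrank' hw'
            have h2 := hdiff w w' hn hm
            have h3 := norm_le_norm_add_norm_sub
              (HomSystem.scaledDeriv (HomSystem.normalize f) z w)
              (HomSystem.scaledDeriv (HomSystem.normalize g) z' w')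
            rw [div_mul_eq_mul_div, le_div_iff₀ hpos']
            have h4 := mul_le_mul_of_nonneg_left (h3.trans (add_le_add_right h2 _)) hν0
            rw [hn] at h1
            linarith)
        rw [← hμ, le_div_iff₀ hpos'] at hμle
        linarith
    rw [hμε] at key
    -- The claimed `3.504 u` exceeds the `2 u` obtained here.
    nlinarith [mul_nonneg hu0 hν0]
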